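/- Let $V$ be a locally compact Hausdorff space. A $C_0(V)$-correspondence is a (complete) right Hilbert $C_0(V)$-module $X$ with a homomorphism $\phi$ of $C_0(V)$ into the adjointable operators $\mathcal L(X)$ as left action (not assumed nondegenerate); an isomorphism of correspondences is a bijective linear map that respects both actions and the $C_0(V)$-valued inner product. A $C_0(V)$-imprimitivity bimodule is a full $C_0(V)$-correspondence for which $\phi$ is an isomorphism of $C_0(V)$ onto the algebra $\mathcal K(X)$ of compact operators; it is symmetric if $f\cdot\xi=\xi\cdot f$ for all $f\in C_0(V)$ and $\xi\in X$. The Picard invariant of an imprimitivity bimodule is its isomorphism class in the Picard group $\operatorname{Pic} C_0(V)$ of isomorphism classes of $C_0(V)$-imprimitivity bimodules, whose identity element is the class of $C_0(V)$ with its usual operations; it is trivial if it is that identity element. A topological graph $E=(V,E^1,r,s)$ with vertex space $V$ consists of a locally compact Hausdorff space $E^1$, a continuous map $r:E^1\to V$ and a local homeomorphism $s:E^1\to V$. Its topological graph correspondence is $$X_E=\Bigl\{\xi\in C(E^1)\ \Big|\ v\mapsto\sum_{s(e)=v}|\xi(e)|^2\ \text{is in } C_0(V)\Bigr\},$$ with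 $(f\cdot\xi\cdot g)(e)=f(r(e))\,\xi(e)\,g(s(e))$ and $\langle\xi,\eta\rangle(v)=\sum_{s(e)=v}\overline{\xi(e)}\,\eta(e)$. **Theorem.** (1) A symmetric $C_0(V)$-imprimitivity bimodule is isomorphic to a topological graph correspondence $X_E$ (for some topological graph $E$ with vertex space $V$) if and only if its Picard invariant is trivial. (2) Consequently, if the symmetric part of $\operatorname{Pic} C_0(V)$ (the classes of the symmetric imprimitivity bimodules) is nontrivial, then there is a symmetric $C_0(V)$-imprimitivity bimodule that is not isomorphic to any topological graph correspondence with vertex space $V$. (3) If $\operatorname{Pic} C_0(V)$ is nontrivial, then there is a $C_0(V)$-correspondence (possibly with degenerate left action) that is not isomorphic to any topological graph correspondence with vertex space $V$. -/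

import Mathlib

namespace GraphCorr

open scoped ZeroAtInfty ComplexOrder

universe u

noncomputable section

/-! ## The C⋆-algebra `C₀(V)` -/

/-- The usual order on `C₀(V)`: the pointwise order (so `0 ≤ f` means that `f` takes values in
`[0, ∞)`). -/
instance instPartialOrderC0 {V : Type*} [TopologicalSpace V] : PartialOrder C₀(V, ℂ) :=
  PartialOrder.lift (fun f : C₀(V, ℂ) => (f : V → ℂ)) DFunLike.coe_injective

theorem c0_le_def {V : Type*} [TopologicalSpace V] {f g : C₀(V, ℂ)} :
    f ≤ g ↔ ∀ v, f v ≤ g v := Iff.rfl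

instance instStarOrderedRingC0 {V : Type*} [TopologicalSpace V] : StarOrderedRing C₀(V, ℂ) := by
  refine StarOrderedRing.of_nonneg_iff' (fun {x y} h z v => ?_) (fun f => ⟨fun h => ?_, ?_⟩)
  · simpa using h v
  · refine ⟨⟨⟨fun v => ((Real.sqrt (f v).re : ℝ) : ℂ), by fun_prop⟩, ?_⟩, ?_⟩
    · have h1 := (ZeroAtInftyContinuousMapClass.zero_at_infty f)
      have h2 : Continuous fun z : ℂ => ((Real.sqrt z.re : ℝ) : ℂ) := by fun_prop
      simpa [Function.comp_def] using (h2.tendsto 0).comp h1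
    · ext v
      have hv : (0 : ℂ) ≤ f v := h v
      obtain ⟨h1, h2⟩ := Complex.nonneg_iff.1 hv
      simp only [ZeroAtInftyContinuousMap.coe_mul, ZeroAtInftyContinuousMap.coe_star,
        Pi.mul_apply, Pi.star_apply]
      change f v = star ((Real.sqrt (f v).re : ℝ) : ℂ) * ((Real.sqrt (f v).re : ℝ) : ℂ)
      rw [RCLike.star_def, Complex.conj_ofReal, ← Complex.ofReal_mul, Real.mul_self_sqrt h1]
      exact Complex.ext rfl h2.symm
  · rintro ⟨s, rfl⟩ v
    exact star_mul_self_nonneg (s v)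

/-! ## `C₀(V)`-correspondences -/

/-- A `C₀(V)`-correspondence: a (complete) Hilbert `C₀(V)`-module `X`, together with a
homomorphism `left` of `C₀(V)` into the adjointable operators on `X`.

The right action is written `f • ξ`, following the convention of Mathlib's `CStarModule`; since
`C₀(V)` is commutative, `f • ξ` is what is usually written `ξ · f`. The left action `f · ξ` is
`left f ξ`; nothing relates it to `f • ξ`, and it need not be nondegenerate. The inner product
`inner C₀(V, ℂ) ξ η` is conjugate linear in the first and linear in the second variable. -/
structure Correspondence (V : Type u) [TopologicalSpace V] where
  carrier : Type u
  [normedAddCommGroup : NormedAddCommGroup carrier]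
  [normedSpace : NormedSpace ℂ carrier]
  [rightAction : SMul C₀(V, ℂ) carrier]
  [hilbertModule : CStarModule C₀(V, ℂ) carrier]
  [complete : CompleteSpace carrier]
  left : C₀(V, ℂ) →ₙₐ[ℂ] (carrier →L[ℂ] carrier)
  inner_left : ∀ (f : C₀(V, ℂ)) (ξ η : carrier),
    inner C₀(V, ℂ) (left f ξ) η = inner C₀(V, ℂ) ξ (left (star f) η)

namespace Correspondence

variable {V : Type u} [TopologicalSpace V]

instance : CoeSort (Correspondence V) (Type u) := ⟨Correspondence.carrier⟩

attribute [instance] normedAddCommGroup normedSpace rightAction hilbertModule complete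

/-- Isomorphisms of `C₀(V)`-correspondences: bijective linear maps that respect the left action,
the right action and the `C₀(V)`-valued inner product. -/
structure Iso (X Y : Correspondence V) where
  toLinearEquiv : X ≃ₗ[ℂ] Y
  map_left : ∀ (f : C₀(V, ℂ)) (ξ : X), toLinearEquiv (X.left f ξ) = Y.left f (toLinearEquiv ξ)
  map_right : ∀ (f : C₀(V, ℂ)) (ξ : X), toLinearEquiv (f • ξ) = f • toLinearEquiv ξ
  map_inner : ∀ ξ η : X,
    inner C₀(V, ℂ) (toLinearEquiv ξ) (toLinearEquiv η) = inner C₀(V, ℂ) ξ η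

/-- Two correspondences are isomorphic. -/
def IsIsomorphic (X Y : Correspondence V) : Prop := Nonempty (Iso X Y)

theorem IsIsomorphic.refl (X : Correspondence V) : X.IsIsomorphic X :=
  ⟨⟨LinearEquiv.refl ℂ X, fun _ _ => rfl, fun _ _ => rfl, fun _ _ => rfl⟩⟩

theorem IsIsomorphic.symm {X Y : Correspondence V} (h : X.IsIsomorphic Y) :
    Y.IsIsomorphic X := by
  obtain ⟨φ⟩ := h
  refine ⟨⟨φ.toLinearEquiv.symm, fun f ξ => ?_, fun f ξ => ?_, fun ξ η => ?_⟩⟩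
  · rw [LinearEquiv.symm_apply_eq, φ.map_left, LinearEquiv.apply_symm_apply]
  · rw [LinearEquiv.symm_apply_eq, φ.map_right, LinearEquiv.apply_symm_apply]
  · rw [← φ.map_inner, LinearEquiv.apply_symm_apply, LinearEquiv.apply_symm_apply]

theorem IsIsomorphic.trans {X Y Z : Correspondence V} (h : X.IsIsomorphic Y)
    (h' : Y.IsIsomorphic Z) : X.IsIsomorphic Z := by
  obtain ⟨φ⟩ := h
  obtain ⟨ψ⟩ := h'
  exact ⟨⟨φ.toLinearEquiv.trans ψ.toLinearEquiv,
    fun f ξ => by simp [φ.map_left, ψ.map_left],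
    fun f ξ => by simp [φ.map_right, ψ.map_right],
    fun ξ η => by simp [φ.map_inner, ψ.map_inner]⟩⟩

/-! ### Rank-one and compact operators -/

section

variable (X : Correspondence V)

theorem eq_of_inner_eq {x y : X}
    (h : ∀ z : X, inner C₀(V, ℂ) z x = inner C₀(V, ℂ) z y) : x = y := by
  rw [← sub_eq_zero, ← CStarModule.inner_self (A := C₀(V, ℂ)), CStarModule.inner_sub_right, h,
    sub_self]

theorem add_right_smul (f g : C₀(V, ℂ)) (x : X) : (f + g) • x = f • x + g • x :=
  X.eq_of_inner_eq fun z => by simp [add_mul]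

theorem right_smul_add (f : C₀(V, ℂ)) (x y : X) : f • (x + y) = f • x + f • y :=
  X.eq_of_inner_eq fun z => by simp [mul_add]

theorem smul_right_smul (c : ℂ) (f : C₀(V, ℂ)) (x : X) : (c • f) • x = c • (f • x) :=
  X.eq_of_inner_eq fun z => by simp [smul_mul_assoc]

theorem norm_right_smul_le (f : C₀(V, ℂ)) (x : X) : ‖f • x‖ ≤ ‖f‖ * ‖x‖ := by
  refine le_of_sq_le_sq ?_ (by positivity)
  rw [mul_pow, CStarModule.norm_sq_eq C₀(V, ℂ) (x := f • x),
    CStarModule.norm_sq_eq C₀(V, ℂ) (x := x),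
    CStarModule.inner_op_smul_right, CStarModule.inner_op_smul_left]
  calc _ ≤ ‖f‖ * (‖inner C₀(V, ℂ) x x‖ * ‖star f‖) :=
        (norm_mul_le _ _).trans (by gcongr; exact norm_mul_le _ _)
    _ = _ := by
        have h1 : ‖star f‖ = ‖f‖ := norm_star f
        rw [h1]; ring

/-- The rank-one operator `θ_{x,y} : z ↦ x · ⟨y, z⟩`. -/
def rankOne (x y : X) : X →L[ℂ] X :=
  LinearMap.mkContinuous
    { toFun := fun z => inner C₀(V, ℂ) y z • x
      map_add' := fun z w => by rw [CStarModule.inner_add_right, X.add_right_smul]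
      map_smul' := fun c z => by
        rw [CStarModule.inner_smul_right_complex, X.smul_right_smul]; rfl }
    (‖y‖ * ‖x‖)
    fun z => by
      calc _ ≤ ‖inner C₀(V, ℂ) y z‖ * ‖x‖ := X.norm_right_smul_le _ _
        _ ≤ (‖y‖ * ‖z‖) * ‖x‖ := by gcongr; exact CStarModule.norm_inner_le X
        _ = _ := by ring

@[simp] theorem rankOne_apply (x y z : X) : X.rankOne x y z = inner C₀(V, ℂ) y z • x := rfl

/-- The algebra `𝒦(X)` of compact operators: the closed linear span, in the operator norm, of the
rank-one operators. -/
def compacts : Submodule ℂ (X →L[ℂ] X) :=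
  (Submodule.span ℂ {T | ∃ x y : X, T = X.rankOne x y}).topologicalClosure

/-- `X` is full: the inner products span a dense subspace of `C₀(V)`. -/
def IsFull : Prop :=
  (Submodule.span ℂ {f | ∃ x y : X, f = inner C₀(V, ℂ) x y}).topologicalClosure = ⊤

/-- `X` is an imprimitivity bimodule: `X` is full, and the left action is an isomorphism of
`C₀(V)` onto `𝒦(X)`. (The left inner product of `x` and `y` is then the element of `C₀(V)` that
acts on the left as `θ_{x,y}`.) -/
structure IsImprimitivityBimodule : Prop where
  full : X.IsFull
  left_injective : Function.Injective X.left
  range_left : Set.range X.left = (X.compacts : Set (X →L[ℂ] X))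

/-- `X` is symmetric: `f · ξ = ξ · f` for all `f` and `ξ`. -/
def IsSymmetric : Prop := ∀ (f : C₀(V, ℂ)) (ξ : X), X.left f ξ = f • ξ

end

end Correspondence

/-! ## The Picard invariant -/

/-- The trivial bimodule: `C₀(V)` with `f · g = g · f = f g` and `⟨f, g⟩ = f̄ g`. -/
def trivialCorrespondence (V : Type u) [TopologicalSpace V] : Correspondence V where
  carrier := C₀(V, ℂ)
  left := NonUnitalAlgHom.Lmul ℂ C₀(V, ℂ)
  inner_left f g h := by
    change h * star (f * g) = (star f * h) * star g
    have h1 : star (f * g) = star g * star f := star_mul f g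
    rw [h1, ← mul_assoc, mul_comm (h * star g) (star f), mul_assoc (star f) h]

/-- The operations of the trivial bimodule are the expected ones. -/
theorem trivialCorrespondence_spec (V : Type u) [TopologicalSpace V] (f g : C₀(V, ℂ)) :
    (trivialCorrespondence V).left f g = f * g ∧
    (f • (show trivialCorrespondence V from g)) = g * f ∧
    inner C₀(V, ℂ) (show trivialCorrespondence V from f) g = star f * g :=
  ⟨rfl, mul_comm f g, mul_comm g (star f)⟩

theorem exists_mul_star_tendsto {V : Type u} [TopologicalSpace V] (f : C₀(V, ℂ)) :
    f ∈ closure {h : C₀(V, ℂ) | ∃ x y : C₀(V, ℂ), h = y * star x} := by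
  have hl := CStarAlgebra.increasingApproximateUnit C₀(V, ℂ)
  have := hl.neBot
  refine mem_closure_of_tendsto (hl.tendsto_mul_left f)
    (Filter.Eventually.of_forall fun e => ⟨star e, f, by rw [star_star]⟩)

theorem trivialCorrespondence_isImprimitivityBimodule (V : Type u) [TopologicalSpace V] :
    (trivialCorrespondence V).IsImprimitivityBimodule where
  full := by
    rw [Correspondence.IsFull, eq_top_iff]
    intro f _
    refine closure_mono ?_ (exists_mul_star_tendsto f)
    exact Submodule.subset_span
  left_injective := fun f g h => by
    have h0 : (f - g) * star (f - g) = 0 := by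
      have h1 := congrArg (fun T : C₀(V, ℂ) →L[ℂ] C₀(V, ℂ) => T (star (f - g))) h
      change f * star (f - g) = g * star (f - g) at h1
      rw [sub_mul, h1, sub_self]
    exact sub_eq_zero.1 ((CStarRing.mul_star_self_eq_zero_iff (f - g)).1 h0)
  range_left := by
    have key : ∀ x y : C₀(V, ℂ), (trivialCorrespondence V).rankOne x y =
        (ContinuousLinearMap.mul ℂ C₀(V, ℂ)) (x * star y) := fun x y => by
      refine ContinuousLinearMap.ext fun (z : C₀(V, ℂ)) => ?_
      change (z * star y) * x = (x * star y) * z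
      rw [mul_comm (z * star y) x, mul_comm z (star y), mul_assoc x]
    apply Set.Subset.antisymm
    · rintro _ ⟨f, rfl⟩
      have h1 : (ContinuousLinearMap.mul ℂ C₀(V, ℂ)) f ∈
          closure ((ContinuousLinearMap.mul ℂ C₀(V, ℂ)) ''
            {h : C₀(V, ℂ) | ∃ x y : C₀(V, ℂ), h = y * star x}) :=
        image_closure_subset_closure_image (ContinuousLinearMap.continuous _)
          ⟨f, exists_mul_star_tendsto f, rfl⟩
      refine closure_mono ?_ h1
      rintro _ ⟨_, ⟨x, y, rfl⟩, rfl⟩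
      exact Submodule.subset_span ⟨y, x, (key y x).symm⟩
    · have hiso : Isometry (ContinuousLinearMap.mul ℂ C₀(V, ℂ)) :=
        AddMonoidHomClass.isometry_of_norm _ fun f => by
          refine le_antisymm (ContinuousLinearMap.opNorm_mul_apply_le ℂ _ f) ?_
          rcases eq_or_ne f 0 with rfl | hf
          · simp
          · have h1 := ((ContinuousLinearMap.mul ℂ C₀(V, ℂ)) f).le_opNorm (star f)
            have h2 : ‖star f‖ = ‖f‖ := norm_star f
            have h3 : ‖f * star f‖ = ‖f‖ * ‖f‖ := CStarRing.norm_self_mul_star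
            rw [ContinuousLinearMap.mul_apply', h3, h2] at h1
            exact le_of_mul_le_mul_right h1 (norm_pos_iff.2 hf)
      have hcl : IsClosed (LinearMap.range
          (ContinuousLinearMap.mul ℂ C₀(V, ℂ)).toLinearMap : Set (C₀(V, ℂ) →L[ℂ] C₀(V, ℂ))) :=
        hiso.isClosedEmbedding.isClosed_range
      have hle : (trivialCorrespondence V).compacts ≤
          LinearMap.range (ContinuousLinearMap.mul ℂ C₀(V, ℂ)).toLinearMap := by
        refine Submodule.topologicalClosure_minimal _ (Submodule.span_le.2 ?_) hcl
        rintro _ ⟨x, y, rfl⟩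
        exact ⟨_, (key x y).symm⟩
      rintro T hT
      obtain ⟨f, hf⟩ := hle hT
      exact ⟨f, hf⟩

/-- The type of `C₀(V)`-imprimitivity bimodules. -/
def ImprimitivityBimodule (V : Type u) [TopologicalSpace V] : Type (u + 1) :=
  {X : Correspondence V // X.IsImprimitivityBimodule}

/-- Isomorphism of imprimitivity bimodules, as an equivalence relation. An isomorphism of correspondences respects the left
inner products as well, since these are determined by the left action and the rank-one
operators. -/
instance imprimitivitySetoid (V : Type u) [TopologicalSpace V] :
    Setoid (ImprimitivityBimodule V) where
  r X Y := X.1.IsIsomorphic Y.1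
  iseqv := ⟨fun X => .refl X.1, fun h => h.symm, fun h h' => h.trans h'⟩

/-- The Picard group of `C₀(V)`, as a set with an identity element: the set of isomorphism classes
of `C₀(V)`-imprimitivity bimodules. Its product is induced by the balanced tensor product, for which
the class of the trivial bimodule `C₀(V)` is the identity; the product itself is not needed to say
that an element is the identity or that the group is nontrivial. -/
def Pic (V : Type u) [TopologicalSpace V] : Type (u + 1) := Quotient (imprimitivitySetoid V)

/-- The identity element of the Picard group: the class of the trivial bimodule. -/
instance (V : Type u) [TopologicalSpace V] : One (Pic V) :=
  ⟨Quotient.mk _ ⟨trivialCorrespondence V, trivialCorrespondence_isImprimitivityBimodule V⟩⟩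

/-- The Picard invariant of an imprimitivity bimodule: its class in the Picard group. -/
def picardInvariant {V : Type u} [TopologicalSpace V] (X : ImprimitivityBimodule V) : Pic V :=
  Quotient.mk _ X

/-- The symmetric part of the Picard group: the classes of the symmetric bimodules. -/
def symmetricPic (V : Type u) [TopologicalSpace V] : Set (Pic V) :=
  {p | ∃ X : ImprimitivityBimodule V, X.1.IsSymmetric ∧ picardInvariant X = p}

/-! ## Topological graphs and their correspondences -/

/-- A topological graph with vertex space `V`: a locally compact Hausdorff edge space, a continuous
range map and a source map that is a local homeomorphism. -/
structure TopologicalGraph (V : Type u) [TopologicalSpace V] where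
  edges : Type u
  [topology : TopologicalSpace edges]
  [hausdorff : T2Space edges]
  [locallyCompact : LocallyCompactSpace edges]
  r : edges → V
  s : edges → V
  continuous_r : Continuous r
  isLocalHomeomorph_s : IsLocalHomeomorph s

attribute [instance] TopologicalGraph.topology TopologicalGraph.hausdorff
  TopologicalGraph.locallyCompact

open Filter Topology in
/-- If a continuous function on `E` is dominated by one whose sums over the fibres of the local
homeomorphism `s` form a function in `C₀(V)`, then its own sums over the fibres do, too. -/
theorem exists_c0_hasSum {E V F : Type*} [TopologicalSpace E] [T2Space E] [TopologicalSpace V]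
    [NormedAddCommGroup F] [CompleteSpace F] {s : E → V} (hs : IsLocalHomeomorph s)
    {u : E → F} (hu : Continuous u) {w : E → ℝ} (hw : Continuous w) (h : C₀(V, ℝ))
    (hsum : ∀ v, HasSum (fun e : s ⁻¹' {v} => w e) (h v)) (huw : ∀ e, ‖u e‖ ≤ w e) :
    ∃ g : C₀(V, F), ∀ v, HasSum (fun e : s ⁻¹' {v} => u e) (g v) := by
  have hsm : ∀ v, HasSum (fun e : s ⁻¹' {v} => u e) (∑' e : s ⁻¹' {v}, u e) := fun v =>
    ((hsum v).summable.of_norm_bounded fun e => huw e).hasSum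
  set G : V → F := fun v => ∑' e : s ⁻¹' {v}, u e with hG
  have tail : ∀ v (T : Finset (s ⁻¹' {v})),
      ‖G v - ∑ e ∈ T, u e‖ ≤ h v - ∑ e ∈ T, w e := fun v T => by
    have h1 : HasSum ((fun e : s ⁻¹' {v} => u e) ∘ (↑) : {x // x ∉ T} → F)
        (G v - ∑ e ∈ T, u e) := by
      refine (T.hasSum_compl_iff (f := fun e : s ⁻¹' {v} => u e)).2 ?_; simpa using hsm v
    have h2 : HasSum ((fun e : s ⁻¹' {v} => w e) ∘ (↑) : {x // x ∉ T} → ℝ)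
        (h v - ∑ e ∈ T, w e) := by
      refine (T.hasSum_compl_iff (f := fun e : s ⁻¹' {v} => w e)).2 ?_; simpa using hsum v
    exact h1.norm_le_of_bounded h2 fun e => huw e
  have hbound : ∀ v, ‖G v‖ ≤ h v := fun v => by simpa using tail v ∅
  have hcont : Continuous G := by
    rw [continuous_iff_continuousAt]
    intro v₀
    rw [ContinuousAt, Metric.tendsto_nhds]
    intro ε hε
    obtain ⟨T, hT⟩ : ∃ T : Finset (s ⁻¹' {v₀}), h v₀ - ∑ e ∈ T, w e < ε / 3 := by
      have h1 := (hsum v₀).eventually (lt_mem_nhds (show h v₀ - ε / 3 < h v₀ by linarith))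
      obtain ⟨T, hT⟩ := h1.exists
      exact ⟨T, by linarith⟩
    let σ : T → V → E := fun e => hs.localInverseAt (e : s ⁻¹' {v₀}).1
    have hse : ∀ e : T, s (e : s ⁻¹' {v₀}).1 = v₀ := fun e => (e : s ⁻¹' {v₀}).2
    have hsrc : ∀ e : T, v₀ ∈ (hs.localInverseAt (e : s ⁻¹' {v₀}).1).source := fun e => by
      have := hs.apply_self_mem_localInverseAt_source (x := (e : s ⁻¹' {v₀}).1)
      rwa [hse e] at this
    have hσ0 : ∀ e : T, σ e v₀ = (e : s ⁻¹' {v₀}).1 := fun e => by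
      have := hs.localInverseAt_apply_self (x := (e : s ⁻¹' {v₀}).1)
      rwa [hse e] at this
    have hσc : ∀ e : T, ContinuousAt (σ e) v₀ := fun e =>
      (hs.localInverseAt (e : s ⁻¹' {v₀}).1).continuousAt (hsrc e)
    have ev1 : ∀ᶠ v in 𝓝 v₀, ∀ e : T, s (σ e v) = v := by
      rw [eventually_all]
      intro e
      filter_upwards [(hs.localInverseAt (e : s ⁻¹' {v₀}).1).open_source.mem_nhds (hsrc e)]
        with v hv
      exact hs.apply_localInverseAt_of_mem hv
    have hev : ∀ e e' : T, σ e v₀ ≠ σ e' v₀ → ∀ᶠ v in 𝓝 v₀, σ e v ≠ σ e' v := by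
      intro e e' hne
      obtain ⟨A, B, hA, hB, heA, heB, hAB⟩ := t2_separation hne
      filter_upwards [(hσc e).eventually (hA.mem_nhds heA),
        (hσc e').eventually (hB.mem_nhds heB)] with v h1 h2 h3
      exact Set.disjoint_left.1 hAB h1 (h3 ▸ h2)
    have ev2 : ∀ᶠ v in 𝓝 v₀, ∀ e e' : T, e ≠ e' → σ e v ≠ σ e' v := by
      rw [eventually_all]
      intro e
      rw [eventually_all]
      intro e'
      by_cases hee : e = e'
      · simp [hee]
      · have hne : σ e v₀ ≠ σ e' v₀ := by
          rw [hσ0, hσ0]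
          exact fun h' => hee (Subtype.ext (Subtype.ext h'))
        filter_upwards [hev e e' hne] with v hv _ using hv
    have ev3 : ∀ᶠ v in 𝓝 v₀, h v - ∑ e : T, w (σ e v) < ε / 3 := by
      have hc : ContinuousAt (fun v => h v - ∑ e : T, w (σ e v)) v₀ := by
        refine (map_continuous h).continuousAt.sub (tendsto_finsetSum _ fun e _ => ?_)
        exact hw.continuousAt.comp (hσc e)
      refine hc.eventually (gt_mem_nhds ?_)
      simp only [hσ0]
      rw [Finset.sum_coe_sort T (fun e => w e)]
      exact hT
    have ev4 : ∀ᶠ v in 𝓝 v₀, ‖∑ e : T, u (σ e v) - ∑ e ∈ T, u e‖ < ε / 3 := by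
      have hc : ContinuousAt (fun v => ∑ e : T, u (σ e v)) v₀ :=
        tendsto_finsetSum _ fun e _ => hu.continuousAt.comp (hσc e)
      have h1 := Metric.tendsto_nhds.1 hc (ε / 3) (by positivity)
      simp only [hσ0] at h1
      rw [Finset.sum_coe_sort T (fun e => u e)] at h1
      simpa only [dist_eq_norm] using h1
    filter_upwards [ev1, ev2, ev3, ev4] with v h1 h2 h3 h4
    let j : T ↪ s ⁻¹' {v} := ⟨fun e => ⟨σ e v, h1 e⟩, fun e e' hee => by
      by_contra hne
      exact h2 e e' hne (congrArg Subtype.val hee)⟩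
    have h5 := tail v (Finset.univ.map j)
    rw [Finset.sum_map, Finset.sum_map] at h5
    have h6 : ‖G v - ∑ e : T, u (σ e v)‖ ≤ h v - ∑ e : T, w (σ e v) := h5
    have h7 := tail v₀ T
    rw [dist_eq_norm]
    calc ‖G v - G v₀‖ = ‖(G v - ∑ e : T, u (σ e v)) + (∑ e : T, u (σ e v) - ∑ e ∈ T, u e)
          - (G v₀ - ∑ e ∈ T, u e)‖ := by congr 1; abel
      _ ≤ ‖G v - ∑ e : T, u (σ e v)‖ + ‖∑ e : T, u (σ e v) - ∑ e ∈ T, u e‖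
          + ‖G v₀ - ∑ e ∈ T, u e‖ := (norm_sub_le _ _).trans (by gcongr; exact norm_add_le _ _)
      _ < ε := by linarith
  have hzero : Tendsto G (cocompact V) (𝓝 0) :=
    squeeze_zero_norm hbound (ZeroAtInftyContinuousMapClass.zero_at_infty h)
  exact ⟨⟨⟨G, hcont⟩, hzero⟩, hsm⟩

namespace TopologicalGraph

variable {V : Type u} [TopologicalSpace V] (E : TopologicalGraph V)

/-- The space `X_E`: the continuous functions `ξ` on the edge space for which the map
`v ↦ ∑_{s(e) = v} |ξ(e)|²` is (everywhere finite and) in `C₀(V)`. -/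
def sectionSpace : Submodule ℂ C(E.edges, ℂ) where
  carrier := {ξ | ∃ f : C₀(V, ℝ), ∀ v, HasSum (fun e : E.s ⁻¹' {v} => ‖ξ e‖ ^ 2) (f v)}
  zero_mem' := ⟨0, fun v => by simp⟩
  add_mem' := by
    rintro ξ η ⟨f, hf⟩ ⟨g, hg⟩
    have hu : Continuous fun e => ‖(ξ + η) e‖ ^ 2 := by fun_prop
    have hw : Continuous fun e => 2 * (‖ξ e‖ ^ 2 + ‖η e‖ ^ 2) := by fun_prop
    refine exists_c0_hasSum E.isLocalHomeomorph_s hu hw ((2 : ℝ) • (f + g))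
      (fun v => ((hf v).add (hg v)).mul_left 2) (fun e => ?_)
    rw [Real.norm_of_nonneg (by positivity)]
    have h1 : ‖(ξ + η) e‖ ≤ ‖ξ e‖ + ‖η e‖ := norm_add_le _ _
    calc ‖(ξ + η) e‖ ^ 2 ≤ (‖ξ e‖ + ‖η e‖) ^ 2 := by gcongr
      _ ≤ _ := by nlinarith [sq_nonneg (‖ξ e‖ - ‖η e‖)]
  smul_mem' := by
    rintro c ξ ⟨f, hf⟩
    refine ⟨(‖c‖ ^ 2) • f, fun v => ?_⟩
    simpa [mul_pow] using (hf v).mul_left (‖c‖ ^ 2)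

/-- `X_E` as a type, without the topology of `C(E.edges, ℂ)`. -/
def Sections : Type u := E.sectionSpace

namespace Sections

instance : AddCommGroup E.Sections := inferInstanceAs (AddCommGroup E.sectionSpace)
instance : Module ℂ E.Sections := inferInstanceAs (Module ℂ E.sectionSpace)

variable {E}

/-- An element of `X_E` as a continuous function on the edge space. -/
def toFun (ξ : E.Sections) : C(E.edges, ℂ) := ξ.1

@[ext] theorem ext {ξ η : E.Sections} (h : ∀ e, ξ.toFun e = η.toFun e) : ξ = η :=
  Subtype.ext (ContinuousMap.ext h)

theorem toFun_add (ξ η : E.Sections) (e : E.edges) :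
    (ξ + η).toFun e = ξ.toFun e + η.toFun e := rfl
theorem toFun_sub (ξ η : E.Sections) (e : E.edges) :
    (ξ - η).toFun e = ξ.toFun e - η.toFun e := rfl
theorem toFun_zero (e : E.edges) : (0 : E.Sections).toFun e = 0 := rfl
theorem toFun_smul (c : ℂ) (ξ : E.Sections) (e : E.edges) :
    (c • ξ).toFun e = c * ξ.toFun e := rfl

theorem exists_inner (ξ η : E.Sections) : ∃ g : C₀(V, ℂ), ∀ v,
    HasSum (fun e : E.s ⁻¹' {v} => star (ξ.toFun e) * η.toFun e) (g v) := by
  obtain ⟨f, hf⟩ := ξ.2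
  obtain ⟨g, hg⟩ := η.2
  refine exists_c0_hasSum E.isLocalHomeomorph_s (u := fun e => star (ξ.toFun e) * η.toFun e)
    (by fun_prop) (w := fun e => ‖ξ.toFun e‖ ^ 2 + ‖η.toFun e‖ ^ 2) (by fun_prop) (f + g)
    (fun v => (hf v).add (hg v)) (fun e => ?_)
  rw [norm_mul, norm_star]
  nlinarith [sq_nonneg (‖ξ.toFun e‖ - ‖η.toFun e‖), norm_nonneg (ξ.toFun e),
    norm_nonneg (η.toFun e)]

/-- The inner product `⟨ξ, η⟩(v) = ∑_{s(e) = v} conj(ξ(e)) η(e)` on `X_E`. -/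
instance : Inner C₀(V, ℂ) E.Sections where
  inner ξ η := (exists_inner ξ η).choose.copy
    (fun v => ∑' e : E.s ⁻¹' {v}, star (ξ.toFun e) * η.toFun e)
    (funext fun v => ((exists_inner ξ η).choose_spec v).tsum_eq)

theorem inner_apply (ξ η : E.Sections) (v : V) :
    inner C₀(V, ℂ) ξ η v = ∑' e : E.s ⁻¹' {v}, star (ξ.toFun e) * η.toFun e := rfl

theorem hasSum_inner (ξ η : E.Sections) (v : V) :
    HasSum (fun e : E.s ⁻¹' {v} => star (ξ.toFun e) * η.toFun e) (inner C₀(V, ℂ) ξ η v) := by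
  obtain ⟨g, hg⟩ := exists_inner ξ η
  exact (hg v).summable.hasSum

theorem mul_mem (k : C(E.edges, ℂ)) (C : ℝ) (hk : ∀ e, ‖k e‖ ≤ C) (ξ : E.Sections) :
    k * ξ.toFun ∈ E.sectionSpace := by
  obtain ⟨f, hf⟩ := ξ.2
  have hu : Continuous fun e => ‖(k * ξ.toFun) e‖ ^ 2 := by fun_prop
  have hw : Continuous fun e => C ^ 2 * ‖ξ.toFun e‖ ^ 2 := by fun_prop
  refine exists_c0_hasSum E.isLocalHomeomorph_s hu hw ((C ^ 2) • f)
    (fun v => (hf v).mul_left (C ^ 2)) (fun e => ?_)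
  rw [Real.norm_of_nonneg (by positivity), ContinuousMap.mul_apply, norm_mul, mul_pow]
  gcongr
  exact hk e

theorem c0_norm_apply_le (f : C₀(V, ℂ)) (v : V) : ‖f v‖ ≤ ‖f‖ := f.toBCF.norm_coe_le_norm v

theorem c0_norm_le {f : C₀(V, ℂ)} {C : ℝ} (hC : 0 ≤ C) (h : ∀ v, ‖f v‖ ≤ C) : ‖f‖ ≤ C :=
  (BoundedContinuousFunction.norm_le hC (f := f.toBCF)).2 h

/-- The left action `(f · ξ)(e) = f(r(e)) ξ(e)` on `X_E`. -/
def leftMul (f : C₀(V, ℂ)) (ξ : E.Sections) : E.Sections :=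
  ⟨⟨fun e => f (E.r e), (map_continuous f).comp E.continuous_r⟩ * ξ.toFun,
    mul_mem _ ‖f‖ (fun _ => c0_norm_apply_le f _) ξ⟩

/-- The right action `(ξ · f)(e) = ξ(e) f(s(e))` on `X_E`. -/
instance : SMul C₀(V, ℂ) E.Sections where
  smul f ξ := ⟨⟨fun e => f (E.s e), (map_continuous f).comp E.isLocalHomeomorph_s.continuous⟩
    * ξ.toFun, mul_mem _ ‖f‖ (fun _ => c0_norm_apply_le f _) ξ⟩

theorem leftMul_apply (f : C₀(V, ℂ)) (ξ : E.Sections) (e : E.edges) :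
    (leftMul f ξ).toFun e = f (E.r e) * ξ.toFun e := rfl

theorem rightMul_apply (f : C₀(V, ℂ)) (ξ : E.Sections) (e : E.edges) :
    (f • ξ).toFun e = f (E.s e) * ξ.toFun e := rfl

/-- The norm `‖ξ‖ = ‖⟨ξ, ξ⟩‖^{1/2}` on `X_E`. -/
instance : Norm E.Sections := CStarModule.norm C₀(V, ℂ)

theorem hasSum_inner_self (ξ : E.Sections) (v : V) :
    HasSum (fun e : E.s ⁻¹' {v} => ‖ξ.toFun e‖ ^ 2) (inner C₀(V, ℂ) ξ ξ v).re ∧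
      (inner C₀(V, ℂ) ξ ξ v).im = 0 := by
  have h1 := hasSum_inner ξ ξ v
  have h2 : ∀ z : ℂ, star z * z = ((‖z‖ ^ 2 : ℝ) : ℂ) := fun z => by
    rw [RCLike.star_def, Complex.conj_mul']; push_cast; rfl
  simp only [h2] at h1
  refine ⟨?_, ?_⟩
  · have h3 := Complex.hasSum_re h1
    simp only [Complex.ofReal_re] at h3
    exact h3
  · have h3 := Complex.hasSum_im h1
    simp only [Complex.ofReal_im] at h3
    exact h3.unique hasSum_zero

instance : CStarModule C₀(V, ℂ) E.Sections where
  inner_add_right {ξ η ζ} := by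
    ext v
    refine (hasSum_inner ξ (η + ζ) v).unique ?_
    simp only [toFun_add, mul_add]
    exact (hasSum_inner ξ η v).add (hasSum_inner ξ ζ v)
  inner_self_nonneg {ξ} := fun v => by
    obtain ⟨h1, h2⟩ := hasSum_inner_self ξ v
    exact Complex.nonneg_iff.2 ⟨h1.nonneg fun e => by positivity, h2.symm⟩
  inner_self {ξ} := by
    constructor
    · intro h
      ext e
      have h1 := (hasSum_inner_self ξ (E.s e)).1
      rw [h] at h1
      have h2 := (hasSum_zero_iff_of_nonneg (fun e => by positivity)).1 h1
      have h3 := congrFun h2 ⟨e, rfl⟩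
      simpa [toFun_zero] using h3
    · rintro rfl
      ext v
      refine (hasSum_inner 0 0 v).unique ?_
      simp [toFun_zero]
  inner_op_smul_right {f ξ η} := by
    ext v
    refine (hasSum_inner ξ (f • η) v).unique ?_
    have h1 := (hasSum_inner ξ η v).mul_left (f v)
    have h2 : ∀ e : E.s ⁻¹' {v}, star (ξ.toFun e) * (f • η).toFun e =
        f v * (star (ξ.toFun e) * η.toFun e) := fun e => by
      rw [rightMul_apply, show E.s e = v from e.2, mul_left_comm]
    simp only [h2]
    exact h1
  inner_smul_right_complex {z ξ η} := by
    ext v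
    refine (hasSum_inner ξ (z • η) v).unique ?_
    have := (hasSum_inner ξ η v).mul_left z
    simp only [toFun_smul, mul_left_comm]
    exact this
  star_inner ξ η := by
    ext v
    refine HasSum.unique ?_ (hasSum_inner η ξ v)
    have := (hasSum_inner ξ η v).star
    simp only [star_mul, star_star] at this
    exact this
  norm_eq_sqrt_norm_inner_self ξ := rfl

theorem inner_sub_left' (ξ η ζ : E.Sections) : inner C₀(V, ℂ) (ξ - η) ζ =
    inner C₀(V, ℂ) ξ ζ - inner C₀(V, ℂ) η ζ :=
  CStarModule.inner_sub_left (A := C₀(V, ℂ)) (E := E.Sections)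

theorem inner_sub_right' (ξ η ζ : E.Sections) : inner C₀(V, ℂ) ξ (η - ζ) =
    inner C₀(V, ℂ) ξ η - inner C₀(V, ℂ) ξ ζ :=
  CStarModule.inner_sub_right (A := C₀(V, ℂ)) (E := E.Sections)

theorem norm_inner_le' (ξ η : E.Sections) : ‖inner C₀(V, ℂ) ξ η‖ ≤ ‖ξ‖ * ‖η‖ :=
  CStarModule.norm_inner_le (A := C₀(V, ℂ)) E.Sections

instance : NormedAddCommGroup E.Sections :=
  NormedAddCommGroup.ofCore (CStarModule.normedSpaceCore C₀(V, ℂ))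

instance : NormedSpace ℂ E.Sections :=
  NormedSpace.ofCore (CStarModule.normedSpaceCore C₀(V, ℂ))

theorem sum_le_norm_sq (ξ : E.Sections) (v : V) (T : Finset (E.s ⁻¹' {v})) :
    ∑ e ∈ T, ‖ξ.toFun e‖ ^ 2 ≤ ‖ξ‖ ^ 2 := by
  rw [CStarModule.norm_sq_eq C₀(V, ℂ)]
  have h1 := (hasSum_inner_self ξ v).1
  calc _ ≤ (inner C₀(V, ℂ) ξ ξ v).re := sum_le_hasSum T (fun e _ => by positivity) h1
    _ ≤ ‖inner C₀(V, ℂ) ξ ξ v‖ := Complex.re_le_norm _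
    _ ≤ _ := c0_norm_apply_le _ v

theorem norm_le_of_sum_le (ξ : E.Sections) {C : ℝ} (hC : 0 ≤ C)
    (h : ∀ v (T : Finset (E.s ⁻¹' {v})), ∑ e ∈ T, ‖ξ.toFun e‖ ^ 2 ≤ C ^ 2) : ‖ξ‖ ≤ C := by
  refine le_of_sq_le_sq ?_ hC
  rw [CStarModule.norm_sq_eq C₀(V, ℂ)]
  refine c0_norm_le (by positivity) fun v => ?_
  obtain ⟨h1, h2⟩ := hasSum_inner_self ξ v
  have h3 : inner C₀(V, ℂ) ξ ξ v = (((inner C₀(V, ℂ) ξ ξ v).re : ℝ) : ℂ) :=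
    Complex.ext rfl h2
  rw [h3, Complex.norm_real, Real.norm_of_nonneg (h1.nonneg fun e => by positivity)]
  exact hasSum_le_of_sum_le h1 (h v)

theorem norm_apply_le (ξ : E.Sections) (e : E.edges) : ‖ξ.toFun e‖ ≤ ‖ξ‖ := by
  refine le_of_sq_le_sq ?_ (norm_nonneg _)
  simpa using sum_le_norm_sq ξ (E.s e) {⟨e, rfl⟩}

open Filter Topology in
/-- A pointwise limit `L` of functions `ξ n` in `X_E` is in `X_E` if the convergence is uniform in
the `ℓ²`-norms of the fibres. -/
theorem mem_of_limit {ξ : ℕ → E.Sections} (hξ : CauchySeq ξ)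
    (hC : ∀ ε > 0, ∃ N, ∀ m ≥ N, ∀ n ≥ N, ‖ξ m - ξ n‖ ≤ ε) {L : E.edges → ℂ}
    (hL : ∀ e, Tendsto (fun n => (ξ n).toFun e) atTop (𝓝 (L e)))
    (hfin : ∀ ε > 0, ∃ N, ∀ n ≥ N, ∀ v (T : Finset (E.s ⁻¹' {v})),
      ∑ e ∈ T, ‖(ξ n).toFun e - L e‖ ^ 2 ≤ ε ^ 2) (hLc : Continuous L) :
    (⟨L, hLc⟩ : C(E.edges, ℂ)) ∈ E.sectionSpace := by
  have hcs : CauchySeq fun n => inner C₀(V, ℂ) (ξ n) (ξ n) := by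
    obtain ⟨B, hB0, hB⟩ : ∃ B > 0, ∀ n, ‖ξ n‖ ≤ B := by
      obtain ⟨B, hB⟩ := hξ.norm_bddAbove
      exact ⟨max B 1, by positivity, fun n => le_max_of_le_left (hB ⟨n, rfl⟩)⟩
    refine Metric.cauchySeq_iff.2 fun ε hε => ?_
    obtain ⟨N, hN⟩ := hC (ε / (4 * B)) (by positivity)
    refine ⟨N, fun m hm n hn => ?_⟩
    have h1 : inner C₀(V, ℂ) (ξ m) (ξ m) - inner C₀(V, ℂ) (ξ n) (ξ n) =
        inner C₀(V, ℂ) (ξ m - ξ n) (ξ m) + inner C₀(V, ℂ) (ξ n) (ξ m - ξ n) := by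
      rw [inner_sub_left', inner_sub_right']; abel
    rw [dist_eq_norm, h1]
    calc _ ≤ ‖ξ m - ξ n‖ * ‖ξ m‖ + ‖ξ n‖ * ‖ξ m - ξ n‖ :=
          (norm_add_le _ _).trans (add_le_add (norm_inner_le' _ _) (norm_inner_le' _ _))
      _ ≤ (ε / (4 * B)) * B + B * (ε / (4 * B)) := by
          gcongr
          · exact hN m hm n hn
          · exact hB m
          · exact hB n
          · exact hN m hm n hn
      _ = ε / 2 := by field_simp; ring
      _ < ε := by linarith
  obtain ⟨f, hf⟩ := cauchySeq_tendsto_of_complete hcs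
  have hfv : ∀ v, Tendsto (fun n => (inner C₀(V, ℂ) (ξ n) (ξ n) v).re) atTop
      (𝓝 (f v).re) := fun v => by
    have h1 := (ZeroAtInftyContinuousMap.tendsto_iff_tendstoUniformly.1 hf).tendsto_at v
    exact (Complex.continuous_re.tendsto _).comp h1
  refine ⟨⟨⟨fun v => (f v).re, by fun_prop⟩, ?_⟩, fun v => ?_⟩
  · simpa [Function.comp_def] using (Complex.continuous_re.tendsto 0).comp
      (ZeroAtInftyContinuousMapClass.zero_at_infty f)
  · have hle : ∀ T : Finset (E.s ⁻¹' {v}), ∑ e ∈ T, ‖L e‖ ^ 2 ≤ (f v).re := fun T => by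
      refine le_of_tendsto_of_tendsto
        (tendsto_finsetSum _ fun e _ => (hL e).norm.pow 2) (hfv v)
        (Eventually.of_forall fun n => ?_)
      exact sum_le_hasSum T (fun e _ => by positivity) (hasSum_inner_self (ξ n) v).1
    have hS : Summable fun e : E.s ⁻¹' {v} => ‖L e‖ ^ 2 :=
      summable_of_sum_le (fun e => by positivity) hle
    have hge : ∀ δ : ℝ, 0 < δ → (f v).re ≤ (1 + δ) * ∑' e : E.s ⁻¹' {v}, ‖L e‖ ^ 2 := by
      intro δ hδ
      refine le_of_forall_pos_le_add fun ε hε => ?_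
      obtain ⟨N, hN⟩ := hfin (Real.sqrt (ε / (1 + 1 / δ))) (by positivity)
      refine le_of_tendsto (hfv v) (eventually_atTop.2 ⟨N, fun n hn => ?_⟩)
      refine hasSum_le_of_sum_le (hasSum_inner_self (ξ n) v).1 fun T => ?_
      have h1 := hN n hn v T
      rw [Real.sq_sqrt (by positivity)] at h1
      have h2 : ∀ a b : ℂ, ‖a‖ ^ 2 ≤ (1 + δ) * ‖b‖ ^ 2 + (1 + 1 / δ) * ‖a - b‖ ^ 2 := by
        intro a b
        have h3 : ‖a‖ ≤ ‖b‖ + ‖a - b‖ := by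
          simpa using norm_add_le b (a - b)
        have h4 : ‖a‖ ^ 2 ≤ (‖b‖ + ‖a - b‖) ^ 2 := by gcongr
        have h5 : 0 ≤ (δ * ‖b‖ - ‖a - b‖) ^ 2 / δ := by positivity
        have h6 : (δ * ‖b‖ - ‖a - b‖) ^ 2 / δ =
          δ * ‖b‖ ^ 2 - 2 * ‖b‖ * ‖a - b‖ + 1 / δ * ‖a - b‖ ^ 2 := by
          field_simp; ring
        nlinarith
      calc ∑ e ∈ T, ‖(ξ n).toFun e‖ ^ 2
          ≤ ∑ e ∈ T, ((1 + δ) * ‖L e‖ ^ 2 + (1 + 1 / δ) * ‖(ξ n).toFun e - L e‖ ^ 2) :=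
            Finset.sum_le_sum fun e _ => h2 _ _
        _ = (1 + δ) * ∑ e ∈ T, ‖L e‖ ^ 2
            + (1 + 1 / δ) * ∑ e ∈ T, ‖(ξ n).toFun e - L e‖ ^ 2 := by
            rw [Finset.sum_add_distrib, Finset.mul_sum, Finset.mul_sum]
        _ ≤ (1 + δ) * (∑' e : E.s ⁻¹' {v}, ‖L e‖ ^ 2)
            + (1 + 1 / δ) * (ε / (1 + 1 / δ)) := by
            gcongr
            exact hS.sum_le_tsum T fun e _ => by positivity
        _ = _ := by field_simp
    have hge' : (f v).re ≤ ∑' e : E.s ⁻¹' {v}, ‖L e‖ ^ 2 := by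
      have h1 : Tendsto (fun δ : ℝ => (1 + δ) * ∑' e : E.s ⁻¹' {v}, ‖L e‖ ^ 2) (𝓝[>] 0)
          (𝓝 ((1 + 0) * ∑' e : E.s ⁻¹' {v}, ‖L e‖ ^ 2)) :=
        ((continuous_const.add continuous_id).mul continuous_const).continuousWithinAt
      rw [add_zero, one_mul] at h1
      exact ge_of_tendsto h1 (eventually_mem_nhdsWithin.mono fun δ hδ => hge δ hδ)
    have heq : ∑' e : E.s ⁻¹' {v}, ‖L e‖ ^ 2 = (f v).re :=
      le_antisymm (hS.tsum_le_of_sum_le hle) hge'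
    have h1 := hS.hasSum
    rw [heq] at h1
    exact h1

open Filter Topology in
instance : CompleteSpace E.Sections := by
  refine Metric.complete_of_cauchySeq_tendsto fun ξ hξ => ?_
  have hC : ∀ ε > 0, ∃ N, ∀ m ≥ N, ∀ n ≥ N, ‖ξ m - ξ n‖ ≤ ε := fun ε hε => by
    obtain ⟨N, hN⟩ := Metric.cauchySeq_iff.1 hξ ε hε
    exact ⟨N, fun m hm n hn => by
      have := hN m hm n hn; rw [dist_eq_norm] at this; exact this.le⟩
  have hpt : ∀ e, ∃ l, Tendsto (fun n => (ξ n).toFun e) atTop (𝓝 l) := fun e => by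
    refine cauchySeq_tendsto_of_complete (Metric.cauchySeq_iff.2 fun ε hε => ?_)
    obtain ⟨N, hN⟩ := hC (ε / 2) (by positivity)
    refine ⟨N, fun m hm n hn => ?_⟩
    rw [dist_eq_norm, ← toFun_sub]
    exact ((norm_apply_le _ e).trans (hN m hm n hn)).trans_lt (by linarith)
  choose L hL using hpt
  have hfin : ∀ ε > 0, ∃ N, ∀ n ≥ N, ∀ v (T : Finset (E.s ⁻¹' {v})),
      ∑ e ∈ T, ‖(ξ n).toFun e - L e‖ ^ 2 ≤ ε ^ 2 := fun ε hε => by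
    obtain ⟨N, hN⟩ := hC ε hε
    refine ⟨N, fun n hn v T => ?_⟩
    have h1 : Tendsto (fun m => ∑ e ∈ T, ‖(ξ n).toFun e - (ξ m).toFun e‖ ^ 2) atTop
        (𝓝 (∑ e ∈ T, ‖(ξ n).toFun e - L e‖ ^ 2)) :=
      tendsto_finsetSum _ fun e _ => ((tendsto_const_nhds.sub (hL e)).norm.pow 2)
    refine le_of_tendsto h1 (eventually_atTop.2 ⟨N, fun m hm => ?_⟩)
    have h2 := sum_le_norm_sq (ξ n - ξ m) v T
    simp only [toFun_sub] at h2
    refine h2.trans ?_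
    gcongr
    exact hN n hn m hm
  have hLc : Continuous L := by
    have hu : TendstoUniformly (fun n e => (ξ n).toFun e) L atTop := by
      rw [Metric.tendstoUniformly_iff]
      intro ε hε
      obtain ⟨N, hN⟩ := hfin (ε / 2) (by positivity)
      filter_upwards [eventually_ge_atTop N] with n hn e
      have h1 := hN n hn (E.s e) {⟨e, rfl⟩}
      rw [Finset.sum_singleton] at h1
      have h2 := le_of_sq_le_sq h1 (by positivity)
      rw [dist_comm, dist_eq_norm]
      linarith
    exact hu.continuous (Frequently.of_forall fun n => (ξ n).toFun.continuous)
  have hmem : (⟨L, hLc⟩ : C(E.edges, ℂ)) ∈ E.sectionSpace := mem_of_limit hξ hC hL hfin hLc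
  let L' : E.Sections := ⟨⟨L, hLc⟩, hmem⟩
  refine ⟨L', Metric.tendsto_atTop.2 fun ε hε => ?_⟩
  obtain ⟨N, hN⟩ := hfin (ε / 2) (by positivity)
  refine ⟨N, fun n hn => ?_⟩
  rw [dist_eq_norm]
  have h1 : ∀ (v : V) (T : Finset (E.s ⁻¹' {v})),
      ∑ e ∈ T, ‖(ξ n - L').toFun e‖ ^ 2 ≤ (ε / 2) ^ 2 := fun v T => by
    have h2 := hN n hn v T
    simp only [toFun_sub]
    exact h2
  exact (norm_le_of_sum_le (ξ n - L') (by positivity) h1).trans_lt (by linarith)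

theorem norm_leftMul_le (f : C₀(V, ℂ)) (ξ : E.Sections) : ‖leftMul f ξ‖ ≤ ‖f‖ * ‖ξ‖ := by
  refine norm_le_of_sum_le _ (by positivity) fun v T => ?_
  calc ∑ e ∈ T, ‖(leftMul f ξ).toFun e‖ ^ 2 ≤ ∑ e ∈ T, ‖f‖ ^ 2 * ‖ξ.toFun e‖ ^ 2 := by
        refine Finset.sum_le_sum fun e _ => ?_
        rw [leftMul_apply, norm_mul, mul_pow]
        gcongr
        exact c0_norm_apply_le f _
    _ ≤ ‖f‖ ^ 2 * ‖ξ‖ ^ 2 := by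
        rw [← Finset.mul_sum]
        gcongr
        exact sum_le_norm_sq ξ v T
    _ = _ := by ring

end Sections

/-- The topological graph correspondence `X_E`. -/
def correspondence : Correspondence V where
  carrier := E.Sections
  left :=
    { toFun := fun f => LinearMap.mkContinuous
        { toFun := Sections.leftMul f
          map_add' := fun ξ η => by
            ext e; simp only [Sections.leftMul_apply, Sections.toFun_add, mul_add]
          map_smul' := fun c ξ => by
            ext e
            simp only [Sections.leftMul_apply, Sections.toFun_smul, mul_left_comm,
              RingHom.id_apply] }
        ‖f‖ (Sections.norm_leftMul_le f)
      map_smul' := fun c f => by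
        ext ξ e; exact mul_assoc _ _ _
      map_zero' := by
        ext ξ e; exact zero_mul _
      map_add' := fun f g => by
        ext ξ e; exact add_mul _ _ _
      map_mul' := fun f g => by
        ext ξ e; exact mul_assoc _ _ _ }
  inner_left f ξ η := by
    ext v
    refine (Sections.hasSum_inner (Sections.leftMul f ξ) η v).unique ?_
    have h2 : ∀ e : E.edges, star ((Sections.leftMul f ξ).toFun e) * η.toFun e =
        star (ξ.toFun e) * (Sections.leftMul (star f) η).toFun e := fun e => by
      rw [Sections.leftMul_apply, Sections.leftMul_apply, star_mul, mul_assoc]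
      rfl
    simp only [h2]
    exact Sections.hasSum_inner ξ (Sections.leftMul (star f) η) v

end TopologicalGraph

end

end GraphCorr

/-!
The graph correspondence `X_E` of a topological graph has many sections supported in a single sheet
of the source map `s`, and these turn algebraic properties of `X_E` into properties of `E`.

* If `X_E` is full, then every fibre of `s` is nonempty
  (`TopologicalGraph.surjective_s_of_isFull`).
* If `e ≠ e'` lie in one fibre of `s`, take sections `ξ`, `η` with `ξ(e) = 1`, `η(e') = 1`,
  `η(e) = 0`. The rank-one operator `θ_{ξ,η}` takes `η` to a section which does not vanish at `e`,
  while every `f · η` vanishes there. So if the left action covers the rank-one operators, then `s`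
  is injective (`TopologicalGraph.injective_s_of_rankOne`).
* If `X_E` is symmetric, then `f(r(e)) = f(s(e))` for all `f`, so `r = s`
  (`TopologicalGraph.r_eq_s_of_isSymmetric`).

A graph whose correspondence is a symmetric imprimitivity bimodule is therefore, via the
homeomorphism `s`, the graph with one loop at each vertex, and composition with `s` identifies
`C₀(V)` with `X_E` (`TopologicalGraph.trivialCorrespondence_isIsomorphic`). The loop graph itself
shows that the trivial bimodule is a graph correspondence. This is the first part of the theorem,
and the second follows.

For the third part, the left action on `X_E` is nondegenerate, so it vanishes only if `X_E = 0`;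
hence `C₀(V)` with zero left action is not a graph correspondence unless `V` is empty, in which
case `Pic C₀(V)` is trivial. A degenerate left action cannot be avoided in general: when `V` has
two points, the flip of `V` gives a nontrivial element of `Pic C₀(V)`, but every nondegenerate
`C₀(V)`-correspondence is a `2 × 2` matrix of Hilbert spaces, and orthonormal bases of these are
the edges of a graph to which it belongs.
-/

namespace GraphCorr

open scoped ZeroAtInfty
open Filter Topology

universe u

/-! ### Bump functions -/

/-- Urysohn's lemma for `C₀(V)`. -/
theorem exists_c0_bump {V : Type*} [TopologicalSpace V] [T2Space V] [LocallyCompactSpace V]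
    {v : V} {U : Set V} (hU : IsOpen U) (hv : v ∈ U) :
    ∃ g : C₀(V, ℂ), g v = 1 ∧ IsCompact (tsupport g) ∧ tsupport g ⊆ U := by
  obtain ⟨f, hf1, hf2, hf3, -⟩ := exists_continuousMap_one_of_isCompact_subset_isOpen
    (isCompact_singleton (x := v)) hU (by simpa using hv)
  have hle : tsupport (fun x => (f x : ℂ)) ⊆ tsupport f :=
    closure_mono fun x hx h => hx (by simp [h])
  have hc : HasCompactSupport fun x => (f x : ℂ) := hf2.of_isClosed_subset (isClosed_tsupport _) hle
  refine ⟨⟨⟨fun x => (f x : ℂ), by fun_prop⟩, hc.is_zero_at_infty⟩, ?_, hc, hle.trans hf3⟩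
  have h := hf1 (Set.mem_singleton v)
  simpa using h

theorem exists_c0_separating {V : Type*} [TopologicalSpace V] [T2Space V] [LocallyCompactSpace V]
    {v w : V} (h : v ≠ w) : ∃ g : C₀(V, ℂ), g v = 1 ∧ g w = 0 := by
  obtain ⟨g, hg1, -, hg2⟩ := exists_c0_bump (isOpen_compl_singleton (x := w)) (v := v) h
  exact ⟨g, hg1, image_eq_zero_of_notMem_tsupport fun hw => hg2 hw rfl⟩

namespace TopologicalGraph

section

variable {V : Type u} [TopologicalSpace V] [T2Space V] [LocallyCompactSpace V]

/-- The section takes the values of a bump function on `V` along one sheet of the local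
homeomorphism `s`, and is zero off this sheet. -/
theorem exists_section_bump (E : TopologicalGraph V) (e : E.edges) {U : Set E.edges}
    (hU : IsOpen U) (he : e ∈ U) :
    ∃ ξ : E.Sections, ξ.toFun e = 1 ∧ ∀ e' ∉ U, ξ.toFun e' = 0 := by
  obtain ⟨φ₀, heφ, hφ₀⟩ := E.isLocalHomeomorph_s e
  obtain ⟨φ, hφe, hφU, hφ⟩ : ∃ φ : OpenPartialHomeomorph E.edges V,
      e ∈ φ.source ∧ φ.source ⊆ U ∧ E.s = φ :=
    ⟨φ₀.restrOpen U hU, ⟨heφ, he⟩, Set.inter_subset_right, hφ₀⟩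
  obtain ⟨g, hg1, hgc, hgt⟩ := exists_c0_bump φ.open_target (φ.map_source hφe)
  set x : E.edges → ℂ := φ.source.indicator fun e' => g (E.s e') with hx
  have hxs : ∀ e' ∈ φ.source, x e' = g (E.s e') := fun e' h => Set.indicator_of_mem h _
  have hx0 : ∀ e' ∉ φ.source, x e' = 0 := fun e' h => Set.indicator_of_notMem h _
  have hsupp : tsupport x ⊆ φ.source := by
    have hK : IsCompact (φ.symm '' tsupport g) :=
      hgc.image_of_continuousOn (φ.continuousOn_symm.mono hgt)
    refine (closure_minimal (fun e' he' => ?_) hK.isClosed).trans ?_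
    · have h : e' ∈ φ.source := by_contra fun h => he' (hx0 e' h)
      refine ⟨φ e', subset_tsupport _ fun h0 => he' ?_, φ.left_inv h⟩
      rw [hxs e' h, hφ, h0]
    · rintro _ ⟨v, hv, rfl⟩
      exact φ.map_target (hgt hv)
  have hxc : Continuous x := continuous_of_tsupport fun e' he' => by
    have h : x =ᶠ[𝓝 e'] fun e' => g (E.s e') := by
      filter_upwards [φ.open_source.mem_nhds (hsupp he')] using hxs
    refine ContinuousAt.congr ?_ h.symm
    exact ((map_continuous g).comp E.isLocalHomeomorph_s.continuous).continuousAt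
  have hmem : (⟨x, hxc⟩ : C(E.edges, ℂ)) ∈ E.sectionSpace := by
    refine ⟨⟨⟨fun v => ‖g v‖ ^ 2, by fun_prop⟩, ?_⟩, fun v => ?_⟩
    · simpa using (ZeroAtInftyContinuousMapClass.zero_at_infty g).norm.pow 2
    change HasSum (fun e : E.s ⁻¹' {v} => ‖x e‖ ^ 2) (‖g v‖ ^ 2)
    by_cases hv : v ∈ φ.target
    · have hs : E.s (φ.symm v) = v := by rw [hφ, φ.right_inv hv]
      have h := hasSum_single (f := fun e : E.s ⁻¹' {v} => ‖x e‖ ^ 2) ⟨φ.symm v, hs⟩ ?_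
      · simpa only [hxs _ (φ.map_target hv), hs] using h
      · rintro ⟨e', rfl⟩ hne
        have h0 : x e' = 0 := hx0 e' fun h => hne (Subtype.ext (by
          change e' = φ.symm (E.s e')
          rw [hφ, φ.left_inv h]))
        simp [h0]
    · have h0 : ∀ e : E.s ⁻¹' {v}, x e = 0 := fun e' => hx0 _ fun h => hv (by
        have := φ.map_source h
        rwa [← hφ, show E.s e' = v from e'.2] at this)
      have hg0 : g v = 0 := image_eq_zero_of_notMem_tsupport fun h => hv (hgt h)
      simp [h0, hg0]
  refine ⟨⟨⟨x, hxc⟩, hmem⟩, ?_, fun e' he' => hx0 e' fun h => he' (hφU h)⟩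
  change x e = 1
  rw [hxs e hφe, hφ, hg1]

/-! ### Properties of the graph detected by its correspondence -/

theorem surjective_s_of_isFull {E : TopologicalGraph V} (h : E.correspondence.IsFull) :
    Function.Surjective E.s := by
  intro v
  by_contra hv
  -- If the fibre over `v` is empty, then all inner products lie in the proper closed ideal of the
  -- functions vanishing at `v`.
  have : IsEmpty (E.s ⁻¹' {v}) := ⟨fun e => hv ⟨e, e.2⟩⟩
  let ev : C₀(V, ℂ) →L[ℂ] ℂ := LinearMap.mkContinuous
    { toFun := fun f => f v, map_add' := fun _ _ => rfl, map_smul' := fun _ _ => rfl } 1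
    fun f => by simpa using Sections.c0_norm_apply_le f v
  have hle : (Submodule.span ℂ {f | ∃ x y : E.correspondence,
      f = inner C₀(V, ℂ) x y}).topologicalClosure ≤ LinearMap.ker ev.toLinearMap := by
    refine Submodule.topologicalClosure_minimal _ (Submodule.span_le.2 ?_) ev.isClosed_ker
    rintro _ ⟨x, y, rfl⟩
    exact (Sections.hasSum_inner (E := E) x y v).unique (hasSum_empty)
  obtain ⟨g, hg, -⟩ := exists_c0_bump isOpen_univ (Set.mem_univ v)
  have hgv : g v = 0 := hle ((h : _ = ⊤) ▸ Submodule.mem_top (x := g))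
  rw [hg] at hgv
  exact one_ne_zero hgv

theorem injective_s_of_rankOne {E : TopologicalGraph V}
    (h : ∀ x y : E.correspondence, ∃ f, E.correspondence.left f = E.correspondence.rankOne x y) :
    Function.Injective E.s := by
  intro e e' hs
  by_contra hne
  obtain ⟨ξ, hξ, -⟩ := E.exists_section_bump e isOpen_univ (Set.mem_univ e)
  obtain ⟨η, hη1, hη0⟩ := E.exists_section_bump e' (U := {e}ᶜ) isOpen_compl_singleton
    (Ne.symm hne)
  have hη0 : η.toFun e = 0 := hη0 e fun h => h rfl
  obtain ⟨f, hf⟩ := h ξ η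
  have h1 : Sections.leftMul f η = inner C₀(V, ℂ) η η • ξ := congrArg (fun T => T η) hf
  have h2 := congrArg (fun ζ : E.Sections => ζ.toFun e) h1
  simp only [Sections.leftMul_apply, Sections.rightMul_apply, hη0, hξ, mul_zero, mul_one] at h2
  have h3 := (Sections.hasSum_inner_self η (E.s e)).1
  rw [← h2] at h3
  have h4 := congrFun ((hasSum_zero_iff_of_nonneg fun e => by positivity).1 h3) ⟨e', hs.symm⟩
  simp [hη1] at h4

theorem r_eq_s_of_isSymmetric {E : TopologicalGraph V} (h : E.correspondence.IsSymmetric) :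
    E.r = E.s := by
  funext e
  by_contra hne
  obtain ⟨f, hf1, hf0⟩ := exists_c0_separating hne
  obtain ⟨ξ, hξ, -⟩ := E.exists_section_bump e isOpen_univ (Set.mem_univ e)
  have h1 : Sections.leftMul f ξ = f • ξ := h f ξ
  have h2 := congrArg (fun ζ : E.Sections => ζ.toFun e) h1
  simp [Sections.leftMul_apply, Sections.rightMul_apply, hξ, hf1, hf0] at h2

/-- A weak form of the nondegeneracy of the left action on `X_E`: a function with value `1` at
`r(e)` fixes the value of every section at `e`. -/
theorem subsingleton_of_left_eq_zero {E : TopologicalGraph V}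
    (h : ∀ f ξ, E.correspondence.left f ξ = 0) : Subsingleton E.correspondence := by
  refine subsingleton_of_forall_eq 0 fun ξ => Sections.ext (E := E) fun e => ?_
  obtain ⟨f, hf, -⟩ := exists_c0_bump isOpen_univ (Set.mem_univ (E.r e))
  have h1 : Sections.leftMul f ξ = (0 : E.Sections) := h f ξ
  have h2 : f (E.r e) * Sections.toFun ξ e = 0 :=
    congrArg (fun ζ : E.Sections => ζ.toFun e) h1
  rwa [hf, one_mul] at h2

end

/-! ### Graphs with one loop at each vertex -/

theorem trivialCorrespondence_isIsomorphic {V : Type u} [TopologicalSpace V]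
    {E : TopologicalGraph V}
    (hs : Function.Bijective E.s) (hr : E.r = E.s) :
    (trivialCorrespondence V).IsIsomorphic E.correspondence := by
  let σ : E.edges ≃ₜ V := E.isLocalHomeomorph_s.toHomeomorphOfBijective hs
  have hsσ : ∀ v, E.s (σ.symm v) = v := σ.apply_symm_apply
  -- The fibres of `s` are singletons, so sums over them have one term.
  have hsum : ∀ {M : Type} [AddCommMonoid M] [TopologicalSpace M] (w : E.edges → M) (v : V),
      HasSum (fun e : E.s ⁻¹' {v} => w e) (w (σ.symm v)) := fun w v => by
    refine hasSum_single (f := fun e : E.s ⁻¹' {v} => w e) ⟨σ.symm v, hsσ v⟩ fun e he => ?_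
    exact (he (Subtype.ext (hs.1 (e.2.trans (hsσ v).symm)))).elim
  let Φ : C₀(V, ℂ) →ₗ[ℂ] E.Sections :=
    { toFun := fun g => ⟨⟨fun e => g (E.s e),
          (map_continuous g).comp E.isLocalHomeomorph_s.continuous⟩,
        ⟨⟨fun v => ‖g v‖ ^ 2, by fun_prop⟩, by
          simpa using (ZeroAtInftyContinuousMapClass.zero_at_infty g).norm.pow 2⟩, fun v => by
          simpa [hsσ] using hsum (fun e => ‖g (E.s e)‖ ^ 2) v⟩
      map_add' := fun _ _ => rfl
      map_smul' := fun _ _ => rfl }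
  have hΦ : ∀ g e, (Φ g).toFun e = g (E.s e) := fun _ _ => rfl
  have hbij : Function.Bijective Φ := by
    refine ⟨fun g g' h => ?_, fun ξ => ?_⟩
    · ext v
      obtain ⟨e, rfl⟩ := hs.2 v
      rw [← hΦ, h, hΦ]
    · obtain ⟨f, hf⟩ := ξ.2
      have hf' : ∀ v, ‖ξ.toFun (σ.symm v)‖ = Real.sqrt (f v) := fun v => by
        rw [(hf v).unique (hsum (fun e => ‖ξ.1 e‖ ^ 2) v), Real.sqrt_sq (norm_nonneg _)]
        rfl
      refine ⟨⟨⟨fun v => ξ.toFun (σ.symm v), by fun_prop⟩, ?_⟩, ?_⟩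
      · refine tendsto_zero_iff_norm_tendsto_zero.2 ?_
        have h := (Real.continuous_sqrt.tendsto 0).comp
          (ZeroAtInftyContinuousMapClass.zero_at_infty f)
        rw [Real.sqrt_zero] at h
        exact h.congr fun v => (hf' v).symm
      · ext e
        exact congrArg ξ.toFun (σ.symm_apply_apply e)
  refine ⟨⟨LinearEquiv.ofBijective Φ hbij, fun f (g : C₀(V, ℂ)) => ?_,
    fun f (g : C₀(V, ℂ)) => ?_, fun (g g' : C₀(V, ℂ)) => ?_⟩⟩
  · refine Sections.ext (E := E) fun e => ?_
    change f (E.s e) * g (E.s e) = f (E.r e) * g (E.s e)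
    rw [hr]
  · refine Sections.ext (E := E) fun e => ?_
    rfl
  · ext v
    refine (Sections.hasSum_inner (Φ g) (Φ g') v).unique ?_
    have h := hsum (fun e => star ((Φ g).toFun e) * (Φ g').toFun e) v
    simp only [hΦ, hsσ] at h
    rw [mul_comm (star (g v))] at h
    exact h

/-- The topological graph with exactly one edge at each vertex, a loop. -/
def loops (V : Type u) [TopologicalSpace V] [T2Space V] [LocallyCompactSpace V] :
    TopologicalGraph V where
  edges := V
  r := id
  s := id
  continuous_r := continuous_id
  isLocalHomeomorph_s := (Homeomorph.refl V).isLocalHomeomorph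

end TopologicalGraph

/-! ### Transport along isomorphisms -/

namespace Correspondence

variable {V : Type u} [TopologicalSpace V] {X Y : Correspondence V}

theorem IsFull.of_iso (φ : Iso X Y) (h : X.IsFull) : Y.IsFull := by
  refine top_le_iff.1 (h.ge.trans (Submodule.topologicalClosure_mono (Submodule.span_mono ?_)))
  rintro _ ⟨x, y, rfl⟩
  exact ⟨_, _, (φ.map_inner x y).symm⟩

theorem IsSymmetric.of_iso (φ : Iso X Y) (h : X.IsSymmetric) : Y.IsSymmetric := fun f y => by
  obtain ⟨x, rfl⟩ := φ.toLinearEquiv.surjective y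
  rw [← φ.map_left, h, φ.map_right]

theorem IsImprimitivityBimodule.exists_left_eq_rankOne (h : X.IsImprimitivityBimodule) (x y : X) :
    ∃ f, X.left f = X.rankOne x y :=
  h.range_left.ge (Submodule.le_topologicalClosure _ (Submodule.subset_span ⟨x, y, rfl⟩))

theorem exists_left_eq_rankOne_of_iso (φ : Iso X Y)
    (h : ∀ x y : X, ∃ f, X.left f = X.rankOne x y) (x y : Y) : ∃ f, Y.left f = Y.rankOne x y := by
  obtain ⟨x, rfl⟩ := φ.toLinearEquiv.surjective x
  obtain ⟨y, rfl⟩ := φ.toLinearEquiv.surjective y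
  obtain ⟨f, hf⟩ := h x y
  refine ⟨f, ContinuousLinearMap.ext fun z => ?_⟩
  obtain ⟨z, rfl⟩ := φ.toLinearEquiv.surjective z
  rw [← φ.map_left, hf, rankOne_apply, rankOne_apply, φ.map_right, φ.map_inner]

end Correspondence

/-! ### The Picard invariant and graph correspondences -/

theorem picardInvariant_eq_one_iff {V : Type u} [TopologicalSpace V]
    (X : ImprimitivityBimodule V) :
    picardInvariant X = 1 ↔ X.1.IsIsomorphic (trivialCorrespondence V) :=
  Quotient.eq (r := imprimitivitySetoid V)

theorem exists_isIsomorphic_correspondence_iff {V : Type u} [TopologicalSpace V] [T2Space V]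
    [LocallyCompactSpace V] (X : ImprimitivityBimodule V) (hX : X.1.IsSymmetric) :
    (∃ E : TopologicalGraph V, X.1.IsIsomorphic E.correspondence) ↔ picardInvariant X = 1 := by
  rw [picardInvariant_eq_one_iff]
  constructor
  · rintro ⟨E, ⟨φ⟩⟩
    have hs : Function.Bijective E.s :=
      ⟨TopologicalGraph.injective_s_of_rankOne
        (Correspondence.exists_left_eq_rankOne_of_iso φ X.2.exists_left_eq_rankOne),
      TopologicalGraph.surjective_s_of_isFull (X.2.full.of_iso φ)⟩
    exact .trans ⟨φ⟩ (TopologicalGraph.trivialCorrespondence_isIsomorphic hs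
      (TopologicalGraph.r_eq_s_of_isSymmetric (hX.of_iso φ))).symm
  · intro h
    exact ⟨TopologicalGraph.loops V, h.trans
      (TopologicalGraph.trivialCorrespondence_isIsomorphic Function.bijective_id rfl)⟩

/-! ### Degenerate left actions -/

/-- `C₀(V)` as a Hilbert module over itself, with the zero left action. -/
noncomputable def zeroLeftCorrespondence (V : Type u) [TopologicalSpace V] : Correspondence V where
  carrier := C₀(V, ℂ)
  left := 0
  inner_left f g h := by simp

theorem subsingleton_pic_of_isEmpty {V : Type u} [TopologicalSpace V] [IsEmpty V] :
    Subsingleton (Pic V) := by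
  have hA : Subsingleton C₀(V, ℂ) := ⟨fun f g => by ext v; exact isEmptyElim v⟩
  have hX : ∀ X : Correspondence V, Subsingleton X := fun X =>
    ⟨fun x y => X.eq_of_inner_eq fun z => Subsingleton.elim _ _⟩
  refine ⟨fun p q => ?_⟩
  induction p using Quotient.inductionOn with | _ X
  induction q using Quotient.inductionOn with | _ Y
  have := hX X.1
  have := hX Y.1
  exact Quotient.sound ⟨⟨0, fun _ _ => Subsingleton.elim _ _, fun _ _ => Subsingleton.elim _ _,
    fun _ _ => Subsingleton.elim _ _⟩⟩

theorem not_zeroLeftCorrespondence_isIsomorphic {V : Type u} [TopologicalSpace V] [T2Space V]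
    [LocallyCompactSpace V] [Nonempty V] (E : TopologicalGraph V) :
    ¬ (zeroLeftCorrespondence V).IsIsomorphic E.correspondence := by
  rintro ⟨φ⟩
  have hE : Subsingleton E.correspondence :=
    TopologicalGraph.subsingleton_of_left_eq_zero fun f ξ => by
      obtain ⟨g, rfl⟩ := φ.toLinearEquiv.surjective ξ
      rw [← φ.map_left]
      exact map_zero φ.toLinearEquiv
  have hA : Subsingleton C₀(V, ℂ) := φ.toLinearEquiv.injective.subsingleton
  obtain ⟨v⟩ := ‹Nonempty V›
  obtain ⟨g, hg, -⟩ := exists_c0_bump isOpen_univ (Set.mem_univ v)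
  rw [Subsingleton.elim g 0] at hg
  exact zero_ne_one hg

end GraphCorr

theorem theorem3p1 (V : Type*) [TopologicalSpace V] [T2Space V] [LocallyCompactSpace V] :
    (∀ X : GraphCorr.ImprimitivityBimodule V, X.1.IsSymmetric →
      ((∃ E : GraphCorr.TopologicalGraph V, X.1.IsIsomorphic E.correspondence) ↔
        GraphCorr.picardInvariant X = 1)) ∧
    ((GraphCorr.symmetricPic V).Nontrivial →
      ∃ X : GraphCorr.ImprimitivityBimodule V, X.1.IsSymmetric ∧
        ∀ E : GraphCorr.TopologicalGraph V, ¬ X.1.IsIsomorphic E.correspondence) ∧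
    (Nontrivial (GraphCorr.Pic V) →
      ∃ X : GraphCorr.Correspondence V,
        ∀ E : GraphCorr.TopologicalGraph V, ¬ X.IsIsomorphic E.correspondence) := by
  refine ⟨GraphCorr.exists_isIsomorphic_correspondence_iff, fun h => ?_, fun h => ?_⟩
  · obtain ⟨_, ⟨X, hX, rfl⟩, hne⟩ := h.exists_ne 1
    exact ⟨X, hX, fun E hE =>
      hne ((GraphCorr.exists_isIsomorphic_correspondence_iff X hX).1 ⟨E, hE⟩)⟩
  · have : Nonempty V := by
      by_contra hV
      have := not_nonempty_iff.1 hV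
      exact not_subsingleton_iff_nontrivial.2 h GraphCorr.subsingleton_pic_of_isEmpty
    exact ⟨_, GraphCorr.not_zeroLeftCorrespondence_isIsomorphic⟩
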